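/- Let $n \ge 2$. Let $K \subset \mathbb{R}^n$ be a convex body (a compact convex set with nonempty interior), and let $M \subset \mathbb{R}^n$ be a convex body with $M = -M$, so that $M$ is the unit ball of the norm $\|x\|_M = \inf\{t > 0 : x \in tM\}$. A supporting line of $K$ is a line that meets $K$ and is contained in a supporting hyperplane of $K$. A tangent segment of $K$ from a point $p$ is a nondegenerate closed segment $[p,q]$ with $q \in K$ that is contained in a supporting line of $K$. Suppose that for every point $p \notin K$ and every two-dimensional affine plane $P$ that contains $p$ and meets the interior of $K$, there are two distinct tangent segments $[p,q_1]$ and $[p,q_2]$ of $K$ from $p$, both contained in $P$, with $\|q_1 - p\|_M = \|q_2 - p\|_M$. Then $K$ and $M$ are homothetic ellipsoids; that is, each of them is the image of the closed Euclidean unit ball under an invertible affine map, and $K = v + rM$ for some $v \in \mathbb{R}^n$ and some $r > 0$. -/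

import Mathlib

open scoped Pointwise

/-- `L` is a supporting line of `K`: a line that meets `K` and lies in a supporting hyperplane
`{x | f x = c}` of `K`. -/
def IsSupportingLine {n : ℕ} (K : Set (EuclideanSpace ℝ (Fin n)))
    (L : AffineSubspace ℝ (EuclideanSpace ℝ (Fin n))) : Prop :=
  Module.finrank ℝ L.direction = 1 ∧ ((L : Set (EuclideanSpace ℝ (Fin n))) ∩ K).Nonempty ∧
    ∃ (f : EuclideanSpace ℝ (Fin n) →L[ℝ] ℝ) (c : ℝ), f ≠ 0 ∧
      (∀ x ∈ K, f x ≤ c) ∧ ∀ x ∈ L, f x = c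

/-- `[p, q]` is a tangent segment of `K` from `p`: it is nondegenerate, `q ∈ K`, and it is contained
in a supporting line of `K`. -/
def IsTangentSegment {n : ℕ} (K : Set (EuclideanSpace ℝ (Fin n)))
    (p q : EuclideanSpace ℝ (Fin n)) : Prop :=
  p ≠ q ∧ q ∈ K ∧ ∃ L : AffineSubspace ℝ (EuclideanSpace ℝ (Fin n)),
    IsSupportingLine K L ∧ segment ℝ p q ⊆ (L : Set (EuclideanSpace ℝ (Fin n)))

/-- `K` has the equal tangent property with respect to the norm with unit ball `M` (that is, the
gauge of `M`): for every `p ∉ K` and every two-dimensional plane `P` that contains `p` and meets the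
interior of `K`, two different tangent segments of `K` from `p` lie in `P` and have equal length. -/
def EqualTangentProperty {n : ℕ} (K M : Set (EuclideanSpace ℝ (Fin n))) : Prop :=
  ∀ p : EuclideanSpace ℝ (Fin n), p ∉ K →
    ∀ P : AffineSubspace ℝ (EuclideanSpace ℝ (Fin n)), Module.finrank ℝ P.direction = 2 →
      p ∈ P → ((P : Set (EuclideanSpace ℝ (Fin n))) ∩ interior K).Nonempty →
        ∃ q₁ q₂ : EuclideanSpace ℝ (Fin n), q₁ ≠ q₂ ∧ q₁ ∈ P ∧ q₂ ∈ P ∧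
          IsTangentSegment K p q₁ ∧ IsTangentSegment K p q₂ ∧
          gauge M (q₁ - p) = gauge M (q₂ - p)

/-- An ellipsoid: the image of the closed Euclidean unit ball under an invertible affine map. -/
def IsEllipsoid {n : ℕ} (S : Set (EuclideanSpace ℝ (Fin n))) : Prop :=
  ∃ A : EuclideanSpace ℝ (Fin n) ≃ᵃ[ℝ] EuclideanSpace ℝ (Fin n),
    S = A '' Metric.closedBall (0 : EuclideanSpace ℝ (Fin n)) 1

/-- `S` and `T` are homothetic: `S = v + r T` for some vector `v` and some `r > 0`. -/
def AreHomothetic {n : ℕ} (S T : Set (EuclideanSpace ℝ (Fin n))) : Prop :=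
  ∃ (r : ℝ) (v : EuclideanSpace ℝ (Fin n)), 0 < r ∧ S = v +ᵥ r • T

open Filter Topology


/-! In the plane, letting an exterior point tend to an edge shows that every interior point of the
edge would be its midpoint, so there are no edges. Hence the support point `G u` of each direction
is unique, and equal tangents make the chord from `G u` to `G v` parallel to `N v • u + N u • v`
(`cross_sub_eq_zero`). These relations for the pairs `±u, ±v` say that `N u • (G u - e)` is a
trace-free linear map `D` of `u`, with `cross (D u) u` proportional to `N u ^ 2`. So `N ^ 2` is a
quadratic form, `D` is a multiple of an `N`-isometry, and the body is an `N`-disc.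

In dimension `n`, every plane section through an interior point is therefore an `N`-disc. The
parallelogram law involves only two vectors, so `N` is Euclidean. All discs through an `N`-diametral
pair share its midpoint and radius, so together they form a ball. -/

/-! ### Determinants and one-sided tangents in the plane. -/

/-- The determinant of two vectors of the coordinate plane. -/
def cross (x y : ℝ × ℝ) : ℝ := x.1 * y.2 - x.2 * y.1

theorem continuous_cross_right (u : ℝ × ℝ) : Continuous fun x => cross u x := by
  unfold cross; fun_prop

theorem normSq_pos {u : ℝ × ℝ} (hu : u ≠ 0) : 0 < u.1 ^ 2 + u.2 ^ 2 := by
  by_contra hcon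
  apply hu
  have h1 : u.1 = 0 := by nlinarith [sq_nonneg u.1, sq_nonneg u.2]
  have h2 : u.2 = 0 := by nlinarith [sq_nonneg u.1, sq_nonneg u.2]
  exact Prod.ext h1 h2

theorem exists_smul_of_cross_eq_zero {u v : ℝ × ℝ} (hu : u ≠ 0) (h : cross u v = 0) :
    ∃ c : ℝ, v = c • u := by
  have hL := normSq_pos hu
  unfold cross at h
  refine ⟨(u.1 * v.1 + u.2 * v.2) / (u.1 ^ 2 + u.2 ^ 2), Prod.ext ?_ ?_⟩
  · simp only [Prod.smul_fst, smul_eq_mul]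
    field_simp
    linear_combination (-u.2) * h
  · simp only [Prod.smul_snd, smul_eq_mul]
    field_simp
    linear_combination u.1 * h

/-- `g` is a point of `K` through which the line of direction `u` has `K` on its left. -/
def IsSupportPoint (K : Set (ℝ × ℝ)) (u g : ℝ × ℝ) : Prop :=
  g ∈ K ∧ ∀ x ∈ K, 0 ≤ cross u (x - g)

theorem exists_isSupportPoint {K : Set (ℝ × ℝ)} (hK : IsCompact K) (hne : K.Nonempty)
    (u : ℝ × ℝ) : ∃ g, IsSupportPoint K u g := by
  obtain ⟨g, hg, hmin⟩ := hK.exists_isMinOn hne (continuous_cross_right u).continuousOn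
  refine ⟨g, hg, fun x hx => ?_⟩
  have := hmin hx
  simp only [Set.mem_ofPred_eq, cross] at this
  simp only [cross, Prod.fst_sub, Prod.snd_sub]
  linarith

/-- From each exterior point there are a left and a right tangent segment of equal length. -/
def PlanarEqualTangents (K : Set (ℝ × ℝ)) (N : Seminorm ℝ (ℝ × ℝ)) : Prop :=
  ∀ p, p ∉ K → ∃ q₁ ∈ K, ∃ q₂ ∈ K, N (q₁ - p) = N (q₂ - p) ∧
    (∀ x ∈ K, 0 ≤ cross (q₁ - p) (x - p)) ∧ ∀ x ∈ K, cross (q₂ - p) (x - p) ≤ 0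

/-- Two tangents with `K` on the same side would be parallel. Equal lengths then leave only `q₁ =
q₂`, or `p` as the midpoint of `q₁` and `q₂`, which convexity puts in `K`. -/
theorem planarEqualTangents_of_one_sided {K : Set (ℝ × ℝ)} {N : Seminorm ℝ (ℝ × ℝ)}
    (hconv : Convex ℝ K) (hN : ∀ x, x ≠ 0 → 0 < N x)
    (h : ∀ p, p ∉ K → ∃ q₁ ∈ K, ∃ q₂ ∈ K, q₁ ≠ q₂ ∧ N (q₁ - p) = N (q₂ - p) ∧
      ((∀ x ∈ K, 0 ≤ cross (q₁ - p) (x - p)) ∨ ∀ x ∈ K, cross (q₁ - p) (x - p) ≤ 0) ∧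
      ((∀ x ∈ K, 0 ≤ cross (q₂ - p) (x - p)) ∨ ∀ x ∈ K, cross (q₂ - p) (x - p) ≤ 0)) :
    PlanarEqualTangents K N := by
  intro p hp
  obtain ⟨q₁, h₁, q₂, h₂, hne, hNe, hs₁, hs₂⟩ := h p hp
  have key : cross (q₁ - p) (q₂ - p) ≠ 0 := by
    intro hz
    have hq : q₁ - p ≠ 0 := by
      intro h0; rw [sub_eq_zero] at h0; exact hp (h0 ▸ h₁)
    obtain ⟨c, hc⟩ := exists_smul_of_cross_eq_zero hq hz
    rw [hc, map_smul_eq_mul, Real.norm_eq_abs] at hNe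
    have hpos := hN _ hq
    have habs : |c| = 1 := by
      have : (|c| - 1) * N (q₁ - p) = 0 := by linarith
      rcases mul_eq_zero.1 this with h | h
      · linarith
      · exact absurd h hpos.ne'
    rcases (abs_eq zero_le_one).1 habs with h | h
    · rw [h, one_smul] at hc
      exact hne (sub_left_injective hc.symm)
    · apply hp
      have : p = (1 / 2 : ℝ) • q₁ + (1 / 2 : ℝ) • q₂ := by
        have : q₂ = p + c • (q₁ - p) := by rw [← hc]; abel
        rw [this, h]
        module
      rw [this]
      exact hconv h₁ h₂ (by norm_num) (by norm_num) (by norm_num)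
  have hanti : cross (q₂ - p) (q₁ - p) = -cross (q₁ - p) (q₂ - p) := by
    unfold cross; ring
  rcases hs₁ with hs₁ | hs₁ <;> rcases hs₂ with hs₂ | hs₂
  · exact absurd (le_antisymm (by linarith [hs₂ _ h₁]) (hs₁ _ h₂)) key
  · exact ⟨q₁, h₁, q₂, h₂, hNe, hs₁, hs₂⟩
  · exact ⟨q₂, h₂, q₁, h₁, hNe.symm, hs₂, hs₁⟩
  · exact absurd (le_antisymm (hs₁ _ h₂) (by linarith [hs₂ _ h₁])) key

/-! ### The planar theorem. -/

section Planar

variable {K : Set (ℝ × ℝ)} {N : Seminorm ℝ (ℝ × ℝ)}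

/-- A point in the relative interior of an edge sees both ends of the edge at equal distance. -/
theorem edge_point_eq_midpoint (hK : IsCompact K) (hNc : Continuous N)
    (hN : ∀ x, x ≠ 0 → 0 < N x) (hT : PlanarEqualTangents K N) {u g : ℝ × ℝ} (hu : u ≠ 0)
    (hg : IsSupportPoint K u g) {α β t : ℝ} (hα : IsLeast {s : ℝ | g + s • u ∈ K} α)
    (hβ : IsGreatest {s : ℝ | g + s • u ∈ K} β) (hαt : α < t) (htβ : t < β) :
    β - t = t - α := by
  have hL := normSq_pos hu
  set L := u.1 ^ 2 + u.2 ^ 2 with hLdef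
  set x : ℝ × ℝ := g + t • u with hx
  set ν : ℝ × ℝ := (-u.2, u.1) with hν
  let ε : ℕ → ℝ := fun k => 1 / ((k : ℝ) + 1)
  have hεpos : ∀ k, 0 < ε k := fun k => Nat.one_div_pos_of_nat
  -- `ν` points to the side of the edge line containing `K`, so these points approach `x` from
  -- outside.
  let p : ℕ → ℝ × ℝ := fun k => x - ε k • ν
  have hpK : ∀ k, p k ∉ K := by
    intro k hk
    have := hg.2 _ hk
    have h2 := mul_pos (hεpos k) hL
    simp only [p, hx, hν, cross, Prod.fst_sub, Prod.snd_sub, Prod.fst_add, Prod.snd_add,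
      Prod.smul_fst, Prod.smul_snd, smul_eq_mul] at this
    nlinarith
  have hεlim : Tendsto ε atTop (𝓝 0) := tendsto_one_div_add_atTop_nhds_zero_nat
  have hplim : Tendsto p atTop (𝓝 x) := by
    have := (tendsto_const_nhds (x := x)).sub (hεlim.smul_const ν)
    simpa using this
  choose q₁ h₁ q₂ h₂ hNe hl hr using fun k => hT (p k) (hpK k)
  have ha : g + α • u ∈ K := hα.1
  have hb : g + β • u ∈ K := hβ.1
  -- The ray from `p k` to `q₁ k` has the end `b` on its left, and `q₁ k` is not below the edge
  -- line, so its component along `u` is at least that of `b`.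
  have hξ₁ : ∀ k, (β - t) * L ≤ u.1 * (q₁ k - p k).1 + u.2 * (q₁ k - p k).2 := by
    intro k
    have e1 := hl k _ hb
    have e2 := hg.2 _ (h₁ k)
    have e3 := hεpos k
    simp only [p, hx, hν, cross, Prod.fst_sub, Prod.snd_sub, Prod.fst_add, Prod.snd_add,
      Prod.smul_fst, Prod.smul_snd, smul_eq_mul] at e1 e2 ⊢
    have e4 := mul_nonneg (sub_pos.2 htβ).le e2
    refine le_of_mul_le_mul_left ?_ e3
    rw [hLdef]
    nlinarith
  have hξ₂ : ∀ k, u.1 * (q₂ k - p k).1 + u.2 * (q₂ k - p k).2 ≤ (α - t) * L := by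
    intro k
    have e1 := hr k _ ha
    have e2 := hg.2 _ (h₂ k)
    have e3 := hεpos k
    simp only [p, hx, hν, cross, Prod.fst_sub, Prod.snd_sub, Prod.fst_add, Prod.snd_add,
      Prod.smul_fst, Prod.smul_snd, smul_eq_mul] at e1 e2 ⊢
    have e4 := mul_nonneg (sub_pos.2 hαt).le e2
    refine le_of_mul_le_mul_left ?_ e3
    rw [hLdef]
    nlinarith
  obtain ⟨⟨y₁, y₂⟩, ⟨hy₁, hy₂⟩, φ, hφ, hlim⟩ :=
    (hK.prod hK).tendsto_subseq (x := fun k => (q₁ k, q₂ k)) fun k => ⟨h₁ k, h₂ k⟩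
  have hlim₁ : Tendsto (fun k => q₁ (φ k)) atTop (𝓝 y₁) := (continuous_fst.tendsto _).comp hlim
  have hlim₂ : Tendsto (fun k => q₂ (φ k)) atTop (𝓝 y₂) := (continuous_snd.tendsto _).comp hlim
  have hlimp : Tendsto (fun k => p (φ k)) atTop (𝓝 x) := hplim.comp hφ.tendsto_atTop
  have hd₁ := hlim₁.sub hlimp
  have hd₂ := hlim₂.sub hlimp
  have hNlim : N (y₁ - x) = N (y₂ - x) :=
    tendsto_nhds_unique ((hNc.tendsto _).comp hd₁)
      (((hNc.tendsto _).comp hd₂).congr fun k => (hNe (φ k)).symm)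
  have hcont : Continuous fun z : ℝ × ℝ => u.1 * z.1 + u.2 * z.2 := by fun_prop
  have hX₁ : (β - t) * L ≤ u.1 * (y₁ - x).1 + u.2 * (y₁ - x).2 :=
    ge_of_tendsto' ((hcont.tendsto _).comp hd₁) fun k => hξ₁ (φ k)
  have hX₂ : u.1 * (y₂ - x).1 + u.2 * (y₂ - x).2 ≤ (α - t) * L :=
    le_of_tendsto' ((hcont.tendsto _).comp hd₂) fun k => hξ₂ (φ k)
  have hcc : Continuous fun z : (ℝ × ℝ) × (ℝ × ℝ) => cross z.1 z.2 := by
    unfold cross; fun_prop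
  have hc₁ : 0 ≤ cross (y₁ - x) (g + β • u - x) :=
    ge_of_tendsto' ((hcc.tendsto _).comp (hd₁.prodMk_nhds (tendsto_const_nhds.sub hlimp)))
      fun k => hl (φ k) _ hb
  have hc₂ : cross (y₂ - x) (g + α • u - x) ≤ 0 :=
    le_of_tendsto' ((hcc.tendsto _).comp (hd₂.prodMk_nhds (tendsto_const_nhds.sub hlimp)))
      fun k => hr (φ k) _ ha
  -- The limits of the tangent points lie on the edge line; being in `K`, they must be the two ends
  -- of the edge.
  have hz₁ : cross u (y₁ - x) = 0 := by
    have e2 := hg.2 _ hy₁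
    simp only [hx, cross, Prod.fst_sub, Prod.snd_sub, Prod.fst_add, Prod.snd_add,
      Prod.smul_fst, Prod.smul_snd, smul_eq_mul] at hc₁ e2 ⊢
    refine le_antisymm ?_ (by nlinarith)
    refine le_of_mul_le_mul_left ?_ (sub_pos.2 htβ)
    nlinarith
  have hz₂ : cross u (y₂ - x) = 0 := by
    have e2 := hg.2 _ hy₂
    simp only [hx, cross, Prod.fst_sub, Prod.snd_sub, Prod.fst_add, Prod.snd_add,
      Prod.smul_fst, Prod.smul_snd, smul_eq_mul] at hc₂ e2 ⊢
    refine le_antisymm ?_ (by nlinarith)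
    refine le_of_mul_le_mul_left ?_ (sub_pos.2 hαt)
    nlinarith
  obtain ⟨c₁, hc₁⟩ := exists_smul_of_cross_eq_zero hu hz₁
  obtain ⟨c₂, hc₂⟩ := exists_smul_of_cross_eq_zero hu hz₂
  have hm₁ : t + c₁ ≤ β := hβ.2 (by
    have : g + (t + c₁) • u = y₁ := by
      rw [add_smul, ← hc₁, hx]; abel
    simpa [this] using hy₁)
  have hm₂ : α ≤ t + c₂ := hα.2 (by
    have : g + (t + c₂) • u = y₂ := by
      rw [add_smul, ← hc₂, hx]; abel
    simpa [this] using hy₂)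
  rw [hc₁] at hX₁ hNlim
  rw [hc₂] at hX₂ hNlim
  simp only [Prod.smul_fst, Prod.smul_snd, smul_eq_mul] at hX₁ hX₂
  have hlow₁ : β - t ≤ c₁ := le_of_mul_le_mul_right (by rw [hLdef] at hX₁ ⊢; linarith) hL
  have hlow₂ : c₂ ≤ α - t := le_of_mul_le_mul_right (by rw [hLdef] at hX₂ ⊢; linarith) hL
  rw [map_smul_eq_mul, map_smul_eq_mul, Real.norm_eq_abs, Real.norm_eq_abs,
    abs_of_pos (by linarith), abs_of_neg (by linarith)] at hNlim
  have := mul_right_cancel₀ (hN u hu).ne' hNlim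
  linarith

/-- Two support points would span an edge, and the point one third of the way along it is not its
midpoint. -/
theorem IsSupportPoint.unique (hK : IsCompact K) (hNc : Continuous N)
    (hN : ∀ x, x ≠ 0 → 0 < N x) (hT : PlanarEqualTangents K N) {u g g' : ℝ × ℝ} (hu : u ≠ 0)
    (hg : IsSupportPoint K u g) (hg' : IsSupportPoint K u g') : g = g' := by
  by_contra hne
  have h0 : cross u (g' - g) = 0 := by
    have e1 := hg.2 _ hg'.1
    have e2 := hg'.2 _ hg.1
    simp only [cross, Prod.fst_sub, Prod.snd_sub] at *
    linarith
  obtain ⟨c, hc⟩ := exists_smul_of_cross_eq_zero hu h0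
  have hc0 : c ≠ 0 := by
    rintro rfl
    rw [zero_smul, sub_eq_zero] at hc
    exact hne hc.symm
  have hcK : g + c • u ∈ K := by rw [← hc]; simpa using hg'.1
  have hL := normSq_pos hu
  have hS : IsCompact {s : ℝ | g + s • u ∈ K} := by
    have hcomp : {s : ℝ | g + s • u ∈ K} =
        {s : ℝ | g + s • u ∈ K} ∩ (fun x : ℝ × ℝ =>
          (u.1 * (x - g).1 + u.2 * (x - g).2) / (u.1 ^ 2 + u.2 ^ 2)) '' K := by
      symm
      rw [Set.inter_eq_left]
      intro s hs
      refine ⟨_, hs, ?_⟩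
      simp only [Prod.fst_sub, Prod.snd_sub, Prod.fst_add, Prod.snd_add, Prod.smul_fst,
        Prod.smul_snd, smul_eq_mul]
      field_simp
      ring
    rw [hcomp]
    refine (hK.image (by fun_prop)).inter_left (hK.isClosed.preimage (by fun_prop))
  have h0S : (0 : ℝ) ∈ {s : ℝ | g + s • u ∈ K} := by simpa using hg.1
  obtain ⟨α, hα⟩ := hS.exists_isLeast ⟨_, h0S⟩
  obtain ⟨β, hβ⟩ := hS.exists_isGreatest ⟨_, h0S⟩
  have h1 := hα.2 h0S
  have h2 := hβ.2 h0S
  have h3 := hα.2 hcK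
  have h4 := hβ.2 hcK
  have hαβ : α < β := by
    rcases lt_or_gt_of_ne hc0 with h | h <;> linarith
  have e := edge_point_eq_midpoint hK hNc hN hT hu hg hα hβ
    (t := (2 * α + β) / 3) (by linarith) (by linarith)
  linarith

/-- Tangent segments from an exterior point that have `K` on the same side coincide. -/
theorem tangent_point_unique (hK : IsCompact K) (hNc : Continuous N)
    (hN : ∀ x, x ≠ 0 → 0 < N x) (hT : PlanarEqualTangents K N) {p q u g : ℝ × ℝ} {c : ℝ}
    (hu : u ≠ 0) (hc : c ≠ 0) (hg : IsSupportPoint K u g) (hgp : g - p = c • u)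
    (hq : q ∈ K) (hside : ∀ x ∈ K, 0 ≤ c * cross (q - p) (x - p)) : q = g := by
  have e1 := hside _ hg.1
  have e2 := hg.2 _ hq
  rw [hgp] at e1
  have hz : cross u (q - g) = 0 := by
    refine le_antisymm ?_ e2
    refine le_of_mul_le_mul_left ?_ (pow_pos (abs_pos.2 hc) 2)
    rw [sq_abs]
    have hg1 : g = p + c • u := by rw [← hgp]; abel
    rw [hg1]
    simp only [cross, Prod.fst_sub, Prod.snd_sub, Prod.fst_add, Prod.snd_add,
      Prod.smul_fst, Prod.smul_snd, smul_eq_mul] at e1 ⊢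
    nlinarith
  refine (IsSupportPoint.unique hK hNc hN hT hu hg ⟨hq, fun x hx => ?_⟩).symm
  have e3 := hg.2 _ hx
  simp only [cross, Prod.fst_sub, Prod.snd_sub] at *
  linarith

/-- The chord between two support points bisects the two tangent directions. -/
theorem cross_sub_eq_zero (hK : IsCompact K) (hNc : Continuous N)
    (hN : ∀ x, x ≠ 0 → 0 < N x) (hT : PlanarEqualTangents K N) {u g v k : ℝ × ℝ}
    (hu : u ≠ 0) (hv : v ≠ 0) (hg : IsSupportPoint K u g) (hk : IsSupportPoint K v k) :
    cross (k - g) (N v • u + N u • v) = 0 := by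
  wlog hpos : 0 ≤ cross u v generalizing u v g k
  · have := this hv hu hk hg (by unfold cross at *; linarith)
    simp only [cross, Prod.fst_sub, Prod.snd_sub, Prod.fst_add, Prod.snd_add,
      Prod.smul_fst, Prod.smul_snd, smul_eq_mul] at *
    linarith
  -- For parallel directions, either they agree and so do the support points, or they are opposite
  -- and `N v • u + N u • v` vanishes.
  rcases hpos.eq_or_lt with h0 | hpos
  · obtain ⟨c, rfl⟩ := exists_smul_of_cross_eq_zero hu h0.symm
    rcases le_total 0 c with hc | hc
    · have hc0 : 0 < c := hc.lt_of_ne (by rintro rfl; simp at hv)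
      have : g = k := by
        refine IsSupportPoint.unique hK hNc hN hT hu hg ⟨hk.1, fun x hx => ?_⟩
        refine le_of_mul_le_mul_left ?_ hc0
        have := hk.2 _ hx
        simp only [cross, Prod.smul_fst, Prod.smul_snd, smul_eq_mul] at *
        linarith
      simp [this, cross]
    · rw [map_smul_eq_mul, Real.norm_eq_abs, abs_of_nonpos hc]
      simp only [cross, Prod.fst_add, Prod.snd_add,
        Prod.smul_fst, Prod.smul_snd, smul_eq_mul]
      ring
  -- The two support lines meet at `p`, by Cramer's rule.
  · obtain ⟨σ, τ, hp⟩ : ∃ σ τ : ℝ, g + σ • u = k + τ • v := by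
      refine ⟨cross (k - g) v / cross u v, cross (k - g) u / cross u v, Prod.ext ?_ ?_⟩ <;>
      · simp only [Prod.fst_add, Prod.snd_add, Prod.smul_fst, Prod.smul_snd, smul_eq_mul]
        field_simp
        simp only [cross, Prod.fst_sub, Prod.snd_sub]
        ring
    have hkg : k - g = σ • u - τ • v := by
      have : k = g + σ • u - τ • v := by rw [hp]; abel
      rw [this]; abel
    set p := g + σ • u with hpdef
    by_cases hpK : p ∈ K
    · have e1 : g = p := by
        refine IsSupportPoint.unique hK hNc hN hT hu hg ⟨hpK, fun x hx => ?_⟩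
        have := hg.2 _ hx
        simp only [hpdef, cross, Prod.fst_sub, Prod.snd_sub, Prod.fst_add, Prod.snd_add,
          Prod.smul_fst, Prod.smul_snd, smul_eq_mul] at *
        linarith
      have e2 : k = p := by
        refine IsSupportPoint.unique hK hNc hN hT hv hk ⟨hpK, fun x hx => ?_⟩
        have := hk.2 _ hx
        rw [hp]
        simp only [cross, Prod.fst_sub, Prod.snd_sub, Prod.fst_add, Prod.snd_add,
          Prod.smul_fst, Prod.smul_snd, smul_eq_mul] at *
        linarith
      rw [← e2] at e1
      simp [e1, cross]
    · have hgp : g - p = (-σ) • u := by rw [hpdef, neg_smul]; abel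
      have hkp : k - p = (-τ) • v := by rw [hp, neg_smul]; abel
      have hσ0 : σ ≠ 0 := by
        rintro rfl
        apply hpK
        simpa [hpdef] using hg.1
      have hτ0 : τ ≠ 0 := by
        rintro rfl
        apply hpK
        rw [hp]
        simpa using hk.1
      have hτ : τ < 0 := by
        refine lt_of_le_of_ne (nonpos_of_mul_nonpos_left ?_ hpos) hτ0
        have := hg.2 _ hk.1
        rw [hkg] at this
        simp only [cross, Prod.fst_sub, Prod.snd_sub,
          Prod.smul_fst, Prod.smul_snd, smul_eq_mul] at *
        linarith
      have hσ : 0 < σ := by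
        refine lt_of_le_of_ne (nonneg_of_mul_nonneg_left ?_ hpos) hσ0.symm
        have := hk.2 _ hg.1
        rw [← neg_sub, hkg] at this
        simp only [cross, Prod.fst_sub, Prod.snd_sub, Prod.fst_neg, Prod.snd_neg,
          Prod.smul_fst, Prod.smul_snd, smul_eq_mul] at *
        linarith
      obtain ⟨q₁, h₁, q₂, h₂, hNe, hl, hr⟩ := hT p hpK
      have e1 : q₁ = k := tangent_point_unique hK hNc hN hT hv (neg_ne_zero.2 hτ0) hk hkp h₁
        fun x hx => mul_nonneg (by linarith) (hl x hx)
      have e2 : q₂ = g := tangent_point_unique hK hNc hN hT hu (neg_ne_zero.2 hσ0) hg hgp h₂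
        fun x hx => mul_nonneg_of_nonpos_of_nonpos (by linarith) (hr x hx)
      -- Equal tangents read `-τ * N v = σ * N u`, so `σ • u - τ • v` is proportional to `N v • u +
      -- N u • v`.
      rw [e1, e2, hkp, hgp, map_smul_eq_mul, map_smul_eq_mul, Real.norm_eq_abs,
        Real.norm_eq_abs, abs_of_pos (by linarith), abs_of_neg (by linarith), neg_neg] at hNe
      rw [hkg]
      simp only [cross, Prod.fst_sub, Prod.snd_sub, Prod.fst_add, Prod.snd_add,
          Prod.smul_fst, Prod.smul_snd, smul_eq_mul] at *
      linear_combination (u.2 * v.1 - u.1 * v.2) * hNe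

/-- The trace-free linear map with the given coefficients. -/
def traceFree (p q s : ℝ) (x : ℝ × ℝ) : ℝ × ℝ := (q * x.1 + p * x.2, s * x.1 - q * x.2)

/-- The support points depend affinely on the unit direction, through a trace-free map. -/
theorem PlanarEqualTangents.exists_support_formula (hK : IsCompact K) (hconv : Convex ℝ K)
    (hne : K.Nonempty) (hNc : Continuous N)
    (hN : ∀ x, x ≠ 0 → 0 < N x) (hT : PlanarEqualTangents K N) :
    ∃ (G : ℝ × ℝ → ℝ × ℝ) (e : ℝ × ℝ) (p q s κ : ℝ), e ∈ K ∧ (∀ u, IsSupportPoint K u (G u)) ∧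
      (∀ u, u ≠ 0 → N u • (G u - e) = traceFree p q s u) ∧
      ∀ u, cross (traceFree p q s u) u = κ * N u ^ 2 := by
  choose G hG using exists_isSupportPoint hK hne
  have rel : ∀ x y, x ≠ 0 → y ≠ 0 → cross (G y - G x) (N y • x + N x • y) = 0 :=
    fun x y hx hy => cross_sub_eq_zero hK hNc hN hT hx hy (hG x) (hG y)
  let D : ℝ × ℝ → ℝ × ℝ := fun x => (N x / 2) • (G x - G (-x))
  -- Signed sums of the chord relations for `(±x, ±y)` separate the odd and even parts of `G`: the
  -- form `cross (D x) y` is symmetric, its diagonal is proportional to `N ^ 2`, and `G x + G (-x)`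
  -- does not depend on `x`.
  have rels : ∀ x y, x ≠ 0 → y ≠ 0 → cross (D x) y = cross (D y) x ∧
      N y ^ 2 * cross (D x) x = N x ^ 2 * cross (D y) y ∧
      cross (G y + G (-y) - (G x + G (-x))) x = 0 ∧
      cross (G y + G (-y) - (G x + G (-x))) y = 0 := by
    intro x y hx hy
    have E1 := rel x y hx hy
    have E2 := rel (-x) (-y) (neg_ne_zero.2 hx) (neg_ne_zero.2 hy)
    have E3 := rel x (-y) hx (neg_ne_zero.2 hy)
    have E4 := rel (-x) y (neg_ne_zero.2 hx) hy
    have hNx := hN x hx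
    have hNy := hN y hy
    simp only [map_neg_eq_map] at E2 E3 E4
    simp only [D]
    generalize N x = s at *
    generalize N y = t at *
    simp only [cross, Prod.fst_sub, Prod.snd_sub, Prod.fst_add, Prod.snd_add,
      Prod.smul_fst, Prod.smul_snd, smul_eq_mul, Prod.fst_neg, Prod.snd_neg] at *
    refine ⟨?_, ?_, ?_, ?_⟩
    · linear_combination -(1 / 4) * (E1 + E2 - E3 - E4)
    · linear_combination -(s * t / 4) * (E1 + E2 + E3 + E4)
    · refine (mul_eq_zero.1 (?_ : t * _ = 0)).resolve_left hNy.ne'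
      linear_combination (1 / 2) * (E1 - E2 + E3 - E4)
    · refine (mul_eq_zero.1 (?_ : s * _ = 0)).resolve_left hNx.ne'
      linear_combination (1 / 2) * (E1 - E2 - E3 + E4)
  have hm : ((1, 0) : ℝ × ℝ) ≠ 0 := by simp
  have hw : ((0, 1) : ℝ × ℝ) ≠ 0 := by simp
  have center : ∀ x, x ≠ 0 → G x + G (-x) = G (1, 0) + G (-(1, 0)) := by
    have aux : ∀ x y, x ≠ 0 → y ≠ 0 → cross x y ≠ 0 → G y + G (-y) = G x + G (-x) := by
      intro x y hx hy hxy
      obtain ⟨-, -, h1, h2⟩ := rels x y hx hy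
      obtain ⟨c, hc⟩ := exists_smul_of_cross_eq_zero hx
        (v := G y + G (-y) - (G x + G (-x))) (by unfold cross at *; linarith)
      rw [hc] at h2
      have : c = 0 := by
        refine (mul_eq_zero.1 (?_ : c * cross x y = 0)).resolve_right hxy
        simp only [cross, Prod.smul_fst, Prod.smul_snd, smul_eq_mul] at *
        linarith
      rw [this, zero_smul, sub_eq_zero] at hc
      exact hc
    intro x hx
    by_cases h2 : x.2 = 0
    · have h1 : x.1 ≠ 0 := fun h1 => hx (Prod.ext h1 h2)
      rw [aux _ _ hw hx (by simpa [cross] using h1), aux _ _ hm hw (by simp [cross])]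
    · exact aux _ _ hm hx (by simpa [cross] using h2)
  set e : ℝ × ℝ := (1 / 2 : ℝ) • (G (1, 0) + G (-(1, 0))) with he
  have hGe : ∀ x, x ≠ 0 → N x • (G x - e) = D x := by
    intro x hx
    simp only [D]
    rw [he, ← center x hx]
    module
  have heK : e ∈ K := by
    rw [he, smul_add]
    exact hconv (hG _).1 (hG _).1 (by norm_num) (by norm_num) (by norm_num)
  have D0 : D 0 = 0 := by simp [D]
  -- Symmetry tested against the basis vectors expresses `D x` linearly in `x`; tested on the basis
  -- pair itself, it makes the trace zero.
  obtain ⟨p, q, s, hD⟩ : ∃ p q s : ℝ, ∀ x, D x = traceFree p q s x := by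
    unfold traceFree
    refine ⟨(D (0, 1)).1, (D (1, 0)).1, (D (1, 0)).2, fun x => ?_⟩
    by_cases hx : x = 0
    · simp [hx, D0, Prod.ext_iff]
    · have h1 := (rels x (0, 1) hx hw).1
      have h2 := (rels x (1, 0) hx hm).1
      have h3 := (rels (1, 0) (0, 1) hm hw).1
      simp only [cross] at h1 h2 h3
      refine Prod.ext ?_ ?_ <;> simp only
      · linear_combination h1 - x.1 * h3
      · linear_combination -h2
  obtain ⟨κ, hκ⟩ : ∃ κ : ℝ, ∀ x, cross (D x) x = κ * N x ^ 2 := by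
    refine ⟨cross (D (1, 0)) (1, 0) / N (1, 0) ^ 2, fun x => ?_⟩
    by_cases hx : x = 0
    · simp [hx, cross]
    · have h1 := (rels x (1, 0) hx hm).2.1
      have := hN _ hm
      field_simp
      linarith
  refine ⟨G, e, p, q, s, κ, heK, hG, fun u hu => ?_, fun u => ?_⟩
  · rw [hGe u hu, hD]
  · rw [← hD, hκ]

/-- A planar body with equal tangents is a disc of a Euclidean norm. -/
theorem PlanarEqualTangents.isDisc (hK : IsCompact K) (hconv : Convex ℝ K)
    {a b : ℝ × ℝ} (ha : a ∈ K) (hb : b ∈ K) (hab : a ≠ b) (hNc : Continuous N)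
    (hN : ∀ x, x ≠ 0 → 0 < N x) (hT : PlanarEqualTangents K N) :
    (∀ x y, N (x + y) ^ 2 + N (x - y) ^ 2 = 2 * (N x ^ 2 + N y ^ 2)) ∧
      ∃ (e : ℝ × ℝ) (r : ℝ), 0 < r ∧ ∀ x, x ∈ K ↔ N (x - e) ≤ r := by
  obtain ⟨G, e, p, q, s, κ, heK, hG, hGe, hκ⟩ := hT.exists_support_formula hK hconv ⟨a, ha⟩ hNc hN
  have hN0 : N 0 = 0 := map_zero N
  have hm : ((1, 0) : ℝ × ℝ) ≠ 0 := by simp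
  have hw : ((0, 1) : ℝ × ℝ) ≠ 0 := by simp
  obtain ⟨D, hDdef⟩ : ∃ D, D = traceFree p q s := ⟨_, rfl⟩
  rw [← hDdef] at hGe hκ
  have hD : ∀ x, D x = (q * x.1 + p * x.2, s * x.1 - q * x.2) := by
    intro x; rw [hDdef]; rfl
  have D0 : D 0 = 0 := by simp [hD, Prod.ext_iff]
  have hsupp : ∀ u, u ≠ 0 → ∀ x ∈ K, -(κ * N u) ≤ cross u (x - e) := by
    intro u hu x hx
    have h1 := (hG u).2 x hx
    have hNu := hN u hu
    have h2 := hκ u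
    rw [← hGe u hu] at h2
    refine le_of_mul_le_mul_left ?_ hNu
    have h3 := mul_nonneg hNu.le h1
    simp only [cross, Prod.fst_sub, Prod.snd_sub, Prod.smul_fst, Prod.smul_snd,
      smul_eq_mul] at *
    linarith
  -- Otherwise the bounds for the directions of the coordinate axes squeeze `K` to the point `e`.
  have hκ0 : 0 < κ := by
    by_contra hneg
    have hzero : ∀ x ∈ K, x = e := by
      intro x hx
      have h1 := hsupp _ hm x hx
      have h2 := hsupp _ (neg_ne_zero.2 hm) x hx
      have h3 := hsupp _ hw x hx
      have h4 := hsupp _ (neg_ne_zero.2 hw) x hx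
      have h5 := mul_nonneg (neg_nonneg.2 (not_lt.1 hneg)) (hN _ hm).le
      have h6 := mul_nonneg (neg_nonneg.2 (not_lt.1 hneg)) (hN _ hw).le
      rw [map_neg_eq_map] at h2 h4
      simp only [cross, Prod.fst_sub, Prod.snd_sub, Prod.fst_neg, Prod.snd_neg] at h1 h2 h3 h4
      exact Prod.ext (by linarith) (by linarith)
    exact hab ((hzero a ha).trans (hzero b hb).symm)
  set Δ := q ^ 2 + p * s with hΔ
  -- Cayley–Hamilton for trace zero; `Δ` is minus the determinant.
  have hDD : ∀ x, D (D x) = Δ • x := by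
    intro x
    rw [hD (D x), hD x]
    refine Prod.ext ?_ ?_ <;> simp only [Prod.smul_fst, Prod.smul_snd, smul_eq_mul] <;> ring
  have hND : ∀ x, N (D x) ^ 2 = -Δ * N x ^ 2 := by
    intro x
    refine mul_left_cancel₀ hκ0.ne' ?_
    rw [← hκ, hDD, mul_left_comm, ← hκ]
    simp only [cross, Prod.smul_fst, Prod.smul_snd, smul_eq_mul]
    ring
  have hΔ0 : 0 < -Δ := by
    have h1 := hND (1, 0)
    have h2 := hN _ hm
    have h3 : D (1, 0) ≠ 0 := by
      intro h0
      have := hκ (1, 0)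
      rw [h0] at this
      have h4 : 0 < κ * N (1, 0) ^ 2 := by positivity
      have h5 : cross 0 ((1, 0) : ℝ × ℝ) = 0 := by simp [cross]
      linarith
    have h4 := hN _ h3
    by_contra hcon
    have h5 : 0 < N (D (1, 0)) ^ 2 := by positivity
    have h6 : 0 < N (1, 0) ^ 2 := by positivity
    nlinarith
  set r := √(-Δ) with hr
  have hr0 : 0 < r := Real.sqrt_pos.2 hΔ0
  have hrr : r ^ 2 = -Δ := Real.sq_sqrt hΔ0.le
  have hND' : ∀ x, N (D x) = r * N x := by
    intro x
    refine (pow_left_inj₀ (apply_nonneg N _) (by positivity) two_ne_zero).1 ?_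
    rw [hND, mul_pow, hrr]
  have hDne : ∀ x, x ≠ 0 → D x ≠ 0 := by
    intro x hx h0
    have := hDD x
    rw [h0, D0] at this
    exact smul_ne_zero (by linarith) hx this.symm
  refine ⟨fun x y => ?_, e, r, hr0, fun x => ⟨fun hx => ?_, fun hx => ?_⟩⟩
  · refine mul_left_cancel₀ hκ0.ne' ?_
    have h1 := hκ (x + y)
    have h2 := hκ (x - y)
    have h3 := hκ x
    have h4 := hκ y
    rw [hD] at h1 h2 h3 h4
    simp only [cross, Prod.fst_sub, Prod.snd_sub, Prod.fst_add, Prod.snd_add] at h1 h2 h3 h4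
    linear_combination -h1 - h2 + 2 * h3 + 2 * h4
  · by_cases hxe : x - e = 0
    · rw [hxe, hN0]; exact hr0.le
    -- The direction `-D (x - e)` is chosen because `D` sends it to `r ^ 2 • (x - e)`: its support
    -- point lies on the ray from `e` through `x`.
    · have h1 := hsupp _ (neg_ne_zero.2 (hDne _ hxe)) x hx
      rw [map_neg_eq_map, hND'] at h1
      have h2 := hκ (x - e)
      have h3 := hN _ hxe
      have h4 : cross (-D (x - e)) (x - e) = -cross (D (x - e)) (x - e) := by
        simp only [cross, Prod.fst_neg, Prod.snd_neg]; ring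
      rw [h4, h2] at h1
      refine le_of_mul_le_mul_left ?_ (mul_pos hκ0 h3)
      linarith
  · by_cases hxe : x - e = 0
    · rw [sub_eq_zero] at hxe; rwa [hxe]
    · have h3 := hN _ hxe
      have h1 := hGe _ (neg_ne_zero.2 (hDne _ hxe))
      have h5 : D (-D (x - e)) = (r ^ 2) • (x - e) := by
        rw [hrr, neg_smul, ← hDD, hD, hD (D (x - e))]
        refine Prod.ext ?_ ?_ <;> simp only [Prod.fst_neg, Prod.snd_neg] <;> ring
      rw [h5, map_neg_eq_map, hND'] at h1
      have h2 : x = (1 - N (x - e) / r) • e + (N (x - e) / r) • G (-D (x - e)) := by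
        have : (N (x - e) / r) • (G (-D (x - e)) - e) = x - e := by
          have h6 : N (x - e) / r = (1 / r ^ 2) * (r * N (x - e)) := by field_simp
          rw [h6, mul_smul, h1, smul_smul, one_div_mul_cancel (by positivity), one_smul]
        generalize N (x - e) / r = c at this ⊢
        calc x = e + (x - e) := by abel
          _ = e + c • (G (-D (x - e)) - e) := by rw [this]
          _ = _ := by module
      rw [h2]
      exact hconv heK (hG _).1 (sub_nonneg.2 ((div_le_one hr0).2 hx)) (by positivity) (by ring)

end Planar

/-! ### Euclidean norms and plane sections. -/

/-- A norm satisfying the parallelogram law is the pullback of a Euclidean norm. -/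
theorem Seminorm.exists_linearEquiv_euclidean {V : Type*} [AddCommGroup V] [Module ℝ V]
    [FiniteDimensional ℝ V] (N : Seminorm ℝ V) (hN : ∀ x, x ≠ 0 → 0 < N x)
    (hpar : ∀ x y, N (x + y) ^ 2 + N (x - y) ^ 2 = 2 * (N x ^ 2 + N y ^ 2)) {n : ℕ}
    (hn : Module.finrank ℝ V = n) :
    ∃ φ : V ≃ₗ[ℝ] EuclideanSpace ℝ (Fin n), ∀ x, N x = ‖φ x‖ := by
  let _ : NormedAddCommGroup V := AddGroupNorm.toNormedAddCommGroup
    { N.toAddGroupSeminorm with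
      eq_zero_of_map_eq_zero' := fun x hx => by
        by_contra h0
        exact (hN x h0).ne' hx }
  have hnorm : ∀ x : V, ‖x‖ = N x := fun _ => rfl
  let _ : NormedSpace ℝ V :=
    { norm_smul_le := fun c x => by rw [hnorm, hnorm, map_smul_eq_mul] }
  let _ : InnerProductSpace ℝ V := InnerProductSpace.ofNorm ℝ fun x y => by
    simp only [hnorm]
    linarith [hpar x y]
  subst hn
  refine ⟨(stdOrthonormalBasis ℝ V).repr.toLinearEquiv, fun x => ?_⟩
  rw [LinearIsometryEquiv.coe_toLinearEquiv, LinearIsometryEquiv.norm_map, hnorm]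

section Sections

variable {n : ℕ} {K M : Set (EuclideanSpace ℝ (Fin n))} {N : Seminorm ℝ (EuclideanSpace ℝ (Fin n))}

theorem lt_of_mem_interior_of_forall_le {E : Type*} [NormedAddCommGroup E] [NormedSpace ℝ E]
    {K : Set E} {o : E} (ho : o ∈ interior K) {f : E →L[ℝ] ℝ} (hf : f ≠ 0) {c : ℝ}
    (hc : ∀ x ∈ K, f x ≤ c) : f o < c := by
  obtain ⟨v, hv⟩ : ∃ v, 0 < f v := by
    obtain ⟨v, hv⟩ : ∃ v, f v ≠ 0 := by
      by_contra! h
      exact hf (ContinuousLinearMap.ext h)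
    rcases lt_or_gt_of_ne hv with h | h
    · exact ⟨-v, by simpa using h⟩
    · exact ⟨v, h⟩
  have hev : ∀ᶠ t : ℝ in 𝓝 0, o + t • v ∈ K := by
    have hc : Continuous fun t : ℝ => o + t • v := by fun_prop
    exact hc.continuousAt.eventually (by simpa using mem_interior_iff_mem_nhds.1 ho)
  obtain ⟨ε, hε, h⟩ := Metric.eventually_nhds_iff.1 hev
  have h1 := hc _ (h (y := ε / 2) (by rw [Real.dist_eq, sub_zero, abs_of_pos] <;> linarith))
  rw [map_add, map_smul, smul_eq_mul] at h1
  have := mul_pos (half_pos hε) hv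
  linarith

/-- The supporting functional `f` is below `c` at the interior point `o` and equals `c` at both ends
of the segment, so it is not constant on the plane. Thus `cross (q - p) (x - p)` is a fixed multiple
of `c - f`, which has one sign on `K`. -/
theorem cross_one_sided_of_isTangentSegment {o : EuclideanSpace ℝ (Fin n)} (ho : o ∈ interior K)
    (φ : ℝ × ℝ →ₗ[ℝ] EuclideanSpace ℝ (Fin n)) {p q : ℝ × ℝ}
    (h : IsTangentSegment K (o + φ p) (o + φ q)) :
    (∀ x, o + φ x ∈ K → 0 ≤ cross (q - p) (x - p)) ∨
      ∀ x, o + φ x ∈ K → cross (q - p) (x - p) ≤ 0 := by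
  obtain ⟨-, -, L, ⟨-, -, f, c, hf, hle, hL⟩, hseg⟩ := h
  have hfo := lt_of_mem_interior_of_forall_le ho hf hle
  have hp := hL _ (hseg (left_mem_segment ℝ _ _))
  have hq := hL _ (hseg (right_mem_segment ℝ _ _))
  set A := f (φ (1, 0)) with hA
  set B := f (φ (0, 1)) with hB
  have hφ : ∀ x, f (o + φ x) = f o + (A * x.1 + B * x.2) := by
    intro x
    have : x = x.1 • ((1, 0) : ℝ × ℝ) + x.2 • ((0, 1) : ℝ × ℝ) := by
      ext <;> simp
    rw [map_add, this, map_add, map_smul, map_smul, map_add, map_smul, map_smul, hA, hB]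
    simp only [smul_eq_mul, Prod.fst_add, Prod.snd_add, Prod.smul_fst, Prod.smul_snd]
    ring
  rw [hφ] at hp hq
  have hw : ((-B, A) : ℝ × ℝ) ≠ 0 := by
    intro h0
    rw [Prod.ext_iff] at h0
    simp only [Prod.fst_zero, Prod.snd_zero, neg_eq_zero] at h0
    rw [h0.1, h0.2] at hp
    linarith
  obtain ⟨l, hl⟩ := exists_smul_of_cross_eq_zero hw (v := q - p) (by
    simp only [cross, Prod.fst_sub, Prod.snd_sub]; linarith)
  have key : ∀ x, cross (q - p) (x - p) = l * (c - f (o + φ x)) := by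
    intro x
    rw [hl, hφ]
    simp only [cross, Prod.fst_sub, Prod.snd_sub, Prod.smul_fst, Prod.smul_snd, smul_eq_mul]
    linear_combination l * hp
  rcases le_total 0 l with h0 | h0
  · left
    intro x hx
    rw [key]
    exact mul_nonneg h0 (sub_nonneg.2 (hle _ hx))
  · right
    intro x hx
    rw [key]
    exact mul_nonpos_of_nonpos_of_nonneg h0 (sub_nonneg.2 (hle _ hx))

/-- Sections by planes through interior points are discs of a common Euclidean norm. -/
theorem EqualTangentProperty.planar_section (hK : IsCompact K) (hconv : Convex ℝ K)
    (hKM : EqualTangentProperty K M) (hNM : ∀ x, gauge M x = N x) (hNc : Continuous N)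
    (hN : ∀ x, x ≠ 0 → 0 < N x) {o : EuclideanSpace ℝ (Fin n)} (ho : o ∈ interior K)
    {φ : ℝ × ℝ →ₗ[ℝ] EuclideanSpace ℝ (Fin n)} (hφ : Function.Injective φ) :
    (∀ x y, N (φ x + φ y) ^ 2 + N (φ x - φ y) ^ 2 = 2 * (N (φ x) ^ 2 + N (φ y) ^ 2)) ∧
      ∃ (e : ℝ × ℝ) (r : ℝ), 0 < r ∧ ∀ x, o + φ x ∈ K ↔ N (φ x - φ e) ≤ r := by
  have hφc : Continuous φ := φ.continuous_of_finiteDimensional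
  have hemb : IsClosedEmbedding fun x => o + φ x :=
    (Homeomorph.addLeft o).isClosedEmbedding.comp
      (LinearMap.isClosedEmbedding_of_injective (LinearMap.ker_eq_bot.2 hφ))
  set K' : Set (ℝ × ℝ) := {x | o + φ x ∈ K} with hK'
  have hK'c : IsCompact K' := hemb.isCompact_preimage hK
  have hK'conv : Convex ℝ K' := by
    intro x hx y hy a b ha hb hab
    have := hconv hx hy ha hb hab
    have e : a • (o + φ x) + b • (o + φ y) = o + φ (a • x + b • y) := by
      rw [map_add, map_smul, map_smul, smul_add, smul_add, add_add_add_comm, ← add_smul, hab,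
        one_smul]
    rwa [e] at this
  have h0 : (0 : ℝ × ℝ) ∈ K' := by simpa [hK'] using interior_subset ho
  obtain ⟨t, ht0, ht⟩ : ∃ t : ℝ, 0 < t ∧ ((t, 0) : ℝ × ℝ) ∈ K' := by
    have hev : ∀ᶠ t : ℝ in 𝓝 0, o + φ (t, 0) ∈ K := by
      have hc : Continuous fun t : ℝ => o + φ (t, 0) := by fun_prop
      refine hc.continuousAt.eventually ?_
      have : o + φ ((0 : ℝ), (0 : ℝ)) = o := by
        rw [show ((0 : ℝ), (0 : ℝ)) = 0 from rfl, map_zero, add_zero]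
      simp only [this]
      exact mem_interior_iff_mem_nhds.1 ho
    obtain ⟨ε, hε, h⟩ := Metric.eventually_nhds_iff.1 hev
    exact ⟨ε / 2, half_pos hε,
      h (y := ε / 2) (by rw [Real.dist_eq, sub_zero, abs_of_pos] <;> linarith)⟩
  have hN' : ∀ x, x ≠ 0 → 0 < N.comp φ x := by
    intro x hx
    exact hN _ (by rwa [Ne, map_eq_zero_iff φ hφ])
  have hT : PlanarEqualTangents K' (N.comp φ) := by
    refine planarEqualTangents_of_one_sided hK'conv hN' fun p hp => ?_
    obtain ⟨q₁, q₂, hne, h₁, h₂, ht₁, ht₂, hg⟩ := hKM (o + φ p) hp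
      (AffineSubspace.mk' o (LinearMap.range φ))
      (by rw [AffineSubspace.direction_mk', LinearMap.finrank_range_of_inj hφ]; simp)
      (by simp [AffineSubspace.mem_mk'])
      ⟨o, AffineSubspace.self_mem_mk' _ _, ho⟩
    obtain ⟨z₁, hz₁⟩ := (AffineSubspace.mem_mk').1 h₁
    obtain ⟨z₂, hz₂⟩ := (AffineSubspace.mem_mk').1 h₂
    obtain rfl : o + φ z₁ = q₁ := by rw [hz₁, vsub_eq_sub]; abel
    obtain rfl : o + φ z₂ = q₂ := by rw [hz₂, vsub_eq_sub]; abel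
    refine ⟨z₁, ht₁.2.1, z₂, ht₂.2.1, fun h => hne (by rw [h]), ?_,
      cross_one_sided_of_isTangentSegment ho φ ht₁, cross_one_sided_of_isTangentSegment ho φ ht₂⟩
    rw [hNM, hNM, add_sub_add_left_eq_sub, add_sub_add_left_eq_sub] at hg
    rw [Seminorm.comp_apply, Seminorm.comp_apply, map_sub φ, map_sub φ]
    exact hg
  obtain ⟨hpar, e, r, hr, hball⟩ := hT.isDisc hK'c hK'conv h0 ht
    (by simp [Prod.ext_iff, ht0.ne]) (hNc.comp hφc) hN'
  simp only [Seminorm.comp_apply, map_add, map_sub] at hpar hball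
  exact ⟨hpar, e, r, hr, hball⟩

end Sections

/-! ### From plane sections to the whole body. -/

theorem injective_smul_add_smul {E : Type*} [AddCommGroup E] [Module ℝ E] {u v : E}
    (h : LinearIndependent ℝ ![u, v]) : Function.Injective
      ((LinearMap.toSpanSingleton ℝ E u).coprod (LinearMap.toSpanSingleton ℝ E v)) := by
  rw [← LinearMap.ker_eq_bot, LinearMap.ker_eq_bot']
  rintro ⟨a, b⟩ hab
  obtain ⟨rfl, rfl⟩ := LinearIndependent.pair_iff.1 h a b (by simpa using hab)
  rfl

/-- Supplies a plane containing a given line through the origin and a given point, even when the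
point lies on the line. -/
theorem exists_linearIndependent_pair {E : Type*} [AddCommGroup E] [Module ℝ E]
    [FiniteDimensional ℝ E] (hE : 2 ≤ Module.finrank ℝ E) {u : E} (hu : u ≠ 0) (x : E) :
    ∃ v, LinearIndependent ℝ ![u, v] ∧ ∃ s t : ℝ, x = s • u + t • v := by
  by_cases hx : ∃ c : ℝ, c • u = x
  · obtain ⟨c, rfl⟩ := hx
    obtain ⟨v, hv⟩ : ∃ v, v ∉ Submodule.span ℝ {u} := by
      by_contra! h
      have h1 : Submodule.span ℝ {u} = ⊤ := by
        rw [eq_top_iff]; exact fun v _ => h v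
      have h2 := finrank_span_singleton (K := ℝ) hu
      rw [h1, finrank_top] at h2
      omega
    refine ⟨v, ?_, c, 0, by simp⟩
    rw [LinearIndependent.pair_iff' hu]
    exact fun a ha => hv (Submodule.mem_span_singleton.2 ⟨a, ha⟩)
  · refine ⟨x, ?_, 0, 1, by simp⟩
    rw [LinearIndependent.pair_iff' hu]
    exact fun a ha => hx ⟨a, ha⟩

section Global

variable {n : ℕ} {K M : Set (EuclideanSpace ℝ (Fin n))} {N : Seminorm ℝ (EuclideanSpace ℝ (Fin n))}

theorem EqualTangentProperty.parallelogram (hn : 2 ≤ n) (hK : IsCompact K) (hconv : Convex ℝ K)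
    (hKi : (interior K).Nonempty)
    (hKM : EqualTangentProperty K M) (hNM : ∀ x, gauge M x = N x) (hNc : Continuous N)
    (hN : ∀ x, x ≠ 0 → 0 < N x) (x y : EuclideanSpace ℝ (Fin n)) :
    N (x + y) ^ 2 + N (x - y) ^ 2 = 2 * (N x ^ 2 + N y ^ 2) := by
  obtain ⟨o, ho⟩ := hKi
  by_cases hx : x = 0
  · rw [hx, zero_add, zero_sub, map_neg_eq_map, map_zero]
    ring
  · obtain ⟨v, hv, s, t, rfl⟩ := exists_linearIndependent_pair (by simpa using hn) hx y
    simpa using (hKM.planar_section hK hconv hNM hNc hN ho (injective_smul_add_smul hv)).1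
      (1, 0) (s, t)

/-- The pair `a, b` realizes the `N`-diameter of `K`. A disc section containing both has diameter
exactly `N (b - a)`, so it is centred at their midpoint `e`, whichever plane is taken. -/
theorem EqualTangentProperty.exists_eq_ball (hn : 2 ≤ n) (hK : IsCompact K) (hconv : Convex ℝ K)
    (hKi : (interior K).Nonempty)
    (hKM : EqualTangentProperty K M) (hNM : ∀ x, gauge M x = N x) (hNc : Continuous N)
    (hN : ∀ x, x ≠ 0 → 0 < N x) :
    ∃ (e : EuclideanSpace ℝ (Fin n)) (r : ℝ), 0 < r ∧ ∀ x, x ∈ K ↔ N (x - e) ≤ r := by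
  have hpar := hKM.parallelogram hn hK hconv hKi hNM hNc hN
  have hdim : 2 ≤ Module.finrank ℝ (EuclideanSpace ℝ (Fin n)) := by simpa using hn
  have hsec := fun {o} (ho : o ∈ interior K) {u v} h =>
    (hKM.planar_section hK hconv hNM hNc hN ho (injective_smul_add_smul (u := u) (v := v) h)).2
  obtain ⟨⟨a, b⟩, ⟨ha, hb⟩, hmax⟩ := (hK.prod hK).exists_isMaxOn
    ((hKi.mono interior_subset).prod (hKi.mono interior_subset))
    (f := fun z => N (z.2 - z.1)) (by fun_prop)
  replace hmax : ∀ x ∈ K, ∀ y ∈ K, N (y - x) ≤ N (b - a) := fun x hx y hy =>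
    hmax (a := (x, y)) ⟨hx, hy⟩
  set e : EuclideanSpace ℝ (Fin n) := (1 / 2 : ℝ) • (a + b) with he
  have hab : b - a ≠ 0 := by
    intro h0
    have hsub : K ⊆ {a} := by
      intro x hx
      by_contra hxa
      have h1 := hmax a ha x hx
      have h2 := hN (x - a) (sub_ne_zero.2 hxa)
      rw [h0, map_zero] at h1
      linarith
    have : Nontrivial (EuclideanSpace ℝ (Fin n)) :=
      Module.nontrivial_of_finrank_pos (R := ℝ) (by omega)
    have hne : NeBot (𝓝[≠] a) := Module.punctured_nhds_neBot ℝ _ a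
    have h2 := hKi.mono (interior_mono hsub)
    rw [interior_singleton] at h2
    exact Set.not_nonempty_empty h2
  have hNab := hN _ hab
  set r := N (b - a) / 2 with hr
  have hr0 : 0 < r := half_pos hNab
  have plane : ∀ o ∈ interior K, ∀ v, LinearIndependent ℝ ![b - a, v] →
      (∃ s t : ℝ, o - a = s • (b - a) + t • v) → ∀ z,
      (∃ s t : ℝ, z - a = s • (b - a) + t • v) → (z ∈ K ↔ N (z - e) ≤ r) := by
    rintro o ho v hv ⟨s₀, t₀, hoa⟩
    obtain ⟨e', r', hr', hball⟩ := hsec ho hv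
    simp only [LinearMap.coprod_apply, LinearMap.toSpanSingleton_apply, Prod.forall] at hball
    set c := o + (e'.1 • (b - a) + e'.2 • v) with hc
    have hball' : ∀ z, (∃ s t : ℝ, z - a = s • (b - a) + t • v) →
        (z ∈ K ↔ N (z - c) ≤ r') := by
      rintro z ⟨s, t, hz⟩
      have h1 : z = o + ((s - s₀) • (b - a) + (t - t₀) • v) := by
        have : z = o - (o - a) + (z - a) := by abel
        rw [this, hoa, hz]
        module
      have h2 : z - c = (s - s₀) • (b - a) + (t - t₀) • v - (e'.1 • (b - a) + e'.2 • v) := by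
        rw [h1, hc]; abel
      rw [h2, ← hball, ← h1]
    have hca : c - a = (s₀ + e'.1) • (b - a) + (t₀ + e'.2) • v := by
      have : c - a = (o - a) + (e'.1 • (b - a) + e'.2 • v) := by rw [hc]; abel
      rw [this, hoa]
      module
    have ha' := (hball' a ⟨0, 0, by simp⟩).1 ha
    have hb' := (hball' b ⟨1, 0, by simp⟩).1 hb
    -- The diameter of the disc parallel to `b - a` lies in `K`, so maximality gives `2 * r' ≤ N (b
    -- - a)`; the reverse holds as `a` and `b` are in the disc.
    have hend : ∀ l : ℝ, |l| * N (b - a) ≤ r' → c + l • (b - a) ∈ K := by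
      intro l hl
      refine (hball' _ ⟨s₀ + e'.1 + l, t₀ + e'.2, ?_⟩).2 ?_
      · have : c + l • (b - a) - a = (c - a) + l • (b - a) := by abel
        rw [this, hca]
        module
      · rwa [add_sub_cancel_left, map_smul_eq_mul]
    have hl : |r' / N (b - a)| * N (b - a) ≤ r' := by
      rw [abs_of_pos (by positivity), div_mul_cancel₀ _ hNab.ne']
    have hle := hmax _ (hend (-(r' / N (b - a))) (by rwa [abs_neg])) _ (hend _ hl)
    have hdiff : c + (r' / N (b - a)) • (b - a) - (c + (-(r' / N (b - a))) • (b - a)) =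
        (2 * (r' / N (b - a))) • (b - a) := by module
    rw [hdiff, map_smul_eq_mul, Real.norm_eq_abs, abs_of_pos (by positivity), mul_assoc,
      div_mul_cancel₀ _ hNab.ne'] at hle
    have hge : N (b - a) ≤ N (b - c) + N (a - c) := by
      have := map_sub_le_add N (b - c) (a - c)
      rwa [sub_sub_sub_cancel_right] at this
    have hrr : r' = r := by rw [hr]; linarith
    have hp := hpar (b - c) (a - c)
    rw [sub_sub_sub_cancel_right] at hp
    -- By the parallelogram law, two points of the disc at distance `2 * r'` have its centre as
    -- midpoint.
    have hce : c = e := by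
      by_contra hne
      have h1 : b - c + (a - c) = (2 : ℝ) • (e - c) := by rw [he]; module
      have h2 := hN _ (sub_ne_zero.2 (Ne.symm hne))
      rw [h1, map_smul_eq_mul, Real.norm_eq_abs, abs_of_pos two_pos] at hp
      have h3 := pow_le_pow_left₀ (apply_nonneg N _) ha' 2
      have h4 := pow_le_pow_left₀ (apply_nonneg N _) hb' 2
      have h5 : N (b - a) = 2 * r' := by rw [hrr, hr]; ring
      rw [h5] at hp
      have h6 := pow_pos h2 2
      linarith
    rw [← hrr, ← hce]
    exact hball'
  have hea : e - a = (1 / 2 : ℝ) • (b - a) := by rw [he]; module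
  have hint : ∀ x ∈ interior K, N (x - e) ≤ r := by
    intro x hx
    obtain ⟨v, hv, hxv⟩ := exists_linearIndependent_pair hdim hab (x - a)
    exact (plane x hx v hv hxv x hxv).1 (interior_subset hx)
  -- So far only planes meeting the interior are covered. Prolonging the segment from an interior
  -- point `o` through `e` by length `r` stays in `K`, so `e` is interior, and then every plane
  -- through `a` and `b` qualifies.
  have hei : e ∈ interior K := by
    obtain ⟨o, ho⟩ := hKi
    by_cases hoe : e - o = 0
    · rw [sub_eq_zero] at hoe
      rwa [hoe]
    have hNo := hN _ hoe
    obtain ⟨v, hv, s, t, hov⟩ := exists_linearIndependent_pair hdim hab (o - a)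
    set l := r / N (e - o) with hl
    have hl0 : 0 < l := by positivity
    have hz : e + l • (e - o) ∈ K := by
      refine (plane o ho v hv ⟨s, t, hov⟩ _ ⟨(1 + l) * (1 / 2) - l * s, -(l * t), ?_⟩).2 ?_
      · have : e + l • (e - o) - a = (1 + l) • (e - a) - l • (o - a) := by module
        rw [this, hea, hov]
        module
      · rw [add_sub_cancel_left, map_smul_eq_mul, Real.norm_eq_abs, abs_of_pos hl0, hl,
          div_mul_cancel₀ _ hNo.ne']
    refine hconv.openSegment_interior_self_subset_interior ho hz
      ⟨l / (1 + l), 1 / (1 + l), by positivity, by positivity, by field_simp; ring, ?_⟩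
    have h2 : l / (1 + l) = 1 - 1 / (1 + l) := by field_simp; ring
    have h3 : (1 / (1 + l)) • (1 + l) • (e - o) = e - o := by
      rw [smul_smul, one_div_mul_cancel (by positivity), one_smul]
    calc (l / (1 + l)) • o + (1 / (1 + l)) • (e + l • (e - o))
        = o + (1 / (1 + l)) • (1 + l) • (e - o) := by rw [h2]; module
      _ = e := by rw [h3]; abel
  refine ⟨e, r, hr0, fun x => ⟨fun hx => ?_, fun hx => ?_⟩⟩
  · have hcl : x ∈ closure (interior K) := by
      rw [hconv.closure_interior_eq_closure_of_nonempty_interior hKi]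
      exact subset_closure hx
    exact closure_minimal (t := {x | N (x - e) ≤ r}) hint
      (isClosed_le (by fun_prop) continuous_const) hcl
  · obtain ⟨v, hv, hxv⟩ := exists_linearIndependent_pair hdim hab (x - a)
    exact (plane e hei v hv ⟨1 / 2, 0, by rw [hea, zero_smul, add_zero]⟩ x hxv).2 hx

/-- A ball of a norm that is Euclidean in suitable coordinates is an ellipsoid. -/
theorem isEllipsoid_of_forall_mem_iff {S : Set (EuclideanSpace ℝ (Fin n))}
    (φ : EuclideanSpace ℝ (Fin n) ≃ₗ[ℝ] EuclideanSpace ℝ (Fin n)) {e : EuclideanSpace ℝ (Fin n)}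
    {r : ℝ} (hr : 0 < r) (hS : ∀ x, x ∈ S ↔ ‖φ (x - e)‖ ≤ r) : IsEllipsoid S := by
  refine ⟨((LinearEquiv.smulOfNeZero ℝ _ r hr.ne').trans φ.symm).toAffineEquiv.trans
    (AffineEquiv.constVAdd ℝ _ e), ?_⟩
  ext x
  rw [hS]
  constructor
  · intro hx
    refine ⟨r⁻¹ • φ (x - e), ?_, ?_⟩
    · rw [mem_closedBall_zero_iff, norm_smul, Real.norm_eq_abs, abs_of_pos (inv_pos.2 hr)]
      exact inv_mul_le_one_of_le₀ hx hr.le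
    · simp [smul_smul, hr.ne']
  · rintro ⟨y, hy, rfl⟩
    rw [mem_closedBall_zero_iff] at hy
    simp only [AffineEquiv.trans_apply, LinearEquiv.coe_toAffineEquiv, LinearEquiv.trans_apply,
      LinearEquiv.smulOfNeZero_apply, AffineEquiv.constVAdd_apply, vadd_eq_add,
      add_sub_cancel_left, LinearEquiv.apply_symm_apply, norm_smul, Real.norm_eq_abs, abs_of_pos hr]
    exact mul_le_of_le_one_right hr.le hy

end Global

/-! ### The gauge of `M` as a norm, and the conclusion. -/

theorem theorem1 (n : ℕ) (hn : 2 ≤ n)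
    (K M : ConvexBody (EuclideanSpace ℝ (Fin n)))
    (hK : (interior (K : Set (EuclideanSpace ℝ (Fin n)))).Nonempty)
    (hM : (interior (M : Set (EuclideanSpace ℝ (Fin n)))).Nonempty)
    (hMsymm : ∀ x ∈ M, -x ∈ M)
    (hKM : EqualTangentProperty (K : Set (EuclideanSpace ℝ (Fin n)))
      (M : Set (EuclideanSpace ℝ (Fin n)))) :
    IsEllipsoid (K : Set (EuclideanSpace ℝ (Fin n))) ∧
      IsEllipsoid (M : Set (EuclideanSpace ℝ (Fin n))) ∧
      AreHomothetic (K : Set (EuclideanSpace ℝ (Fin n)))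
        (M : Set (EuclideanSpace ℝ (Fin n))) := by
  -- The origin is the midpoint of an interior point `x` and of `-x`, which lies in `M`.
  have h0 : (M : Set (EuclideanSpace ℝ (Fin n))) ∈ 𝓝 0 := by
    obtain ⟨x, hx⟩ := hM
    rw [← mem_interior_iff_mem_nhds]
    have hneg : -x ∈ (M : Set (EuclideanSpace ℝ (Fin n))) := hMsymm _ (interior_subset hx)
    exact M.convex.openSegment_interior_self_subset_interior hx hneg
      ⟨1 / 2, 1 / 2, by norm_num, by norm_num, by norm_num, by module⟩
  have hbal : Balanced ℝ (M : Set (EuclideanSpace ℝ (Fin n))) := by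
    rw [balanced_iff_smul_mem]
    intro a ha x hx
    rw [Real.norm_eq_abs, abs_le] at ha
    have h2 := M.convex hx (hMsymm x hx) (a := (1 + a) / 2) (b := (1 - a) / 2)
      (by linarith) (by linarith) (by ring)
    have h3 : ((1 + a) / 2) • x + ((1 - a) / 2) • (-x) = a • x := by module
    rwa [h3] at h2
  obtain ⟨N, hNM⟩ : ∃ N : Seminorm ℝ (EuclideanSpace ℝ (Fin n)),
      ∀ x, gauge (M : Set (EuclideanSpace ℝ (Fin n))) x = N x :=
    ⟨gaugeSeminorm hbal M.convex (absorbent_nhds_zero h0), fun _ => rfl⟩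
  have hNc : Continuous N := by
    have := continuous_gauge M.convex h0
    rwa [funext hNM] at this
  have hN : ∀ x, x ≠ 0 → 0 < N x := by
    intro x hx
    rw [← hNM, gauge_pos (absorbent_nhds_zero h0)
      (M.isCompact.totallyBounded.isVonNBounded ℝ)]
    exact hx
  have hMN : ∀ x, x ∈ (M : Set (EuclideanSpace ℝ (Fin n))) ↔ N x ≤ 1 := by
    intro x
    rw [← hNM, gauge_le_one_iff_mem_closure M.convex h0, M.isCompact.isClosed.closure_eq]
  obtain ⟨φ, hφ⟩ := N.exists_linearEquiv_euclidean hN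
    (hKM.parallelogram hn K.isCompact K.convex hK hNM hNc hN) (finrank_euclideanSpace_fin (𝕜 := ℝ))
  obtain ⟨e, r, hr, hball⟩ := hKM.exists_eq_ball hn K.isCompact K.convex hK hNM hNc hN
  refine ⟨isEllipsoid_of_forall_mem_iff φ hr fun x => by rw [hball, hφ],
    isEllipsoid_of_forall_mem_iff φ (e := 0) one_pos fun x => by rw [hMN, hφ, sub_zero],
    r, e, hr, ?_⟩
  ext x
  rw [hball, Set.mem_vadd_set_iff_neg_vadd_mem, Set.mem_smul_set_iff_inv_smul_mem₀ hr.ne', hMN,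
    map_smul_eq_mul, Real.norm_eq_abs, abs_of_pos (inv_pos.2 hr), inv_mul_le_one₀ hr,
    vadd_eq_add, neg_add_eq_sub]
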